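/- Let $m\ge 3$ be an integer, $C_m=\mathbb Z/m\mathbb Z$. A partial Steiner triple system (PSTS) $\mathfrak M=(S,\mathcal L)$ is a set $S$ of points with a family $\mathcal L$ of three-element subsets (lines) such that any two distinct points lie on at most one line. The configuration $m$-weaved from $\mathfrak M$ has point set $S\times C_m$, and its lines are the sets $\{(a,i),(b,j),(c,k)\}$ with $\{a,b,c\}\in\mathcal L$, $i,j,k\in C_m$ and ($i=j=k-1$ or $i=k=j-1$ or $j=k=i-1$). A Desargues subconfiguration of $\mathfrak M$ consists of ten distinct points $o,a_1,a_2,a_3,b_1,b_2,b_3,c_1,c_2,c_3$ such that $\{o,a_i,b_i\}$ ($i=1,2,3$), $\{a_i,a_j,c_k\}$ and $\{b_i,b_j,c_k\}$ ($\{i,j,k\}=\{1,2,3\}$), and $\{c_1,c_2,c_3\}$ are lines of $\mathfrak M$. A Desarguesian projective space is a projective space (any two distinct points lie on exactly one line, every line has at least three points, the Veblen–Young axiom holds; any dimension) in which Desargues' theorem holds. An embedding of an incidence structure into a projective space is an injective map of the points that maps the points of each line into a projective line, with distinct lines going into distinct projective lines. **Theorem.** If a PSTS $\mathfrak M$ contains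 a Desargues subconfiguration, then the configuration $m$-weaved from $\mathfrak M$ cannot be embedded into any Desarguesian projective space. In particular, for every $m\ge 3$, neither - the configuration $m$-weaved from $G_2(X)$, for any (finite or infinite) set $X$ with $|X|\ge 5$, where the points of $G_2(X)$ are the two-element subsets of $X$ and its lines are the three-element subsets of $X$, with inclusion as incidence, nor - the configuration $m$-weaved from $PG(n,2)$, the $n$-dimensional projective space over $GF(2)$, for any $n\ge 3$, can be embedded into a Desarguesian projective space. -/

import Mathlib

open scoped LinearAlgebra.Projectivization

/-!
An incidence structure on a point set `S` is given by its family of lines, a set of subsets of `S`.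
-/

/-- A partial Steiner triple system: every line has exactly three points, and two lines that share
two distinct points are equal. -/
structure IsPartialSteinerTripleSystem {S : Type*} (L : Set (Set S)) : Prop where
  ncard_eq_three : ∀ l ∈ L, l.ncard = 3
  line_unique : ∀ l ∈ L, ∀ l' ∈ L, ∀ p q : S,
    p ≠ q → p ∈ l → q ∈ l → p ∈ l' → q ∈ l' → l = l'

/-- The triples of weights `(i, j, k)` in `C_m` with `i = j = k - 1`, `i = k = j - 1` or
`j = k = i - 1`. -/
def weightTriples (m : ℕ) : Set (ZMod m × ZMod m × ZMod m) :=
  {t | (t.1 = t.2.1 ∧ t.2.1 = t.2.2 - 1) ∨ (t.1 = t.2.2 ∧ t.2.2 = t.2.1 - 1) ∨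
    (t.2.1 = t.2.2 ∧ t.2.2 = t.1 - 1)}

/-- The lines of the configuration `m`-weaved from the structure with line set `L`. -/
def weave {S : Type*} (m : ℕ) (L : Set (Set S)) : Set (Set (S × ZMod m)) :=
  {l | ∃ (a b c : S) (i j k : ZMod m), ({a, b, c} : Set S) ∈ L ∧ (i, j, k) ∈ weightTriples m ∧
    l = {(a, i), (b, j), (c, k)}}

/-- The structure with line set `L` contains the Desargues configuration: ten distinct points and
ten lines, which make up two triangles `a₁ a₂ a₃`, `b₁ b₂ b₃` that are perspective from `o` and
whose corresponding sides meet in the points `c₁, c₂, c₃` of one line. -/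
def ContainsDesargues {S : Type*} (L : Set (Set S)) : Prop :=
  ∃ o a₁ a₂ a₃ b₁ b₂ b₃ c₁ c₂ c₃ : S,
    [o, a₁, a₂, a₃, b₁, b₂, b₃, c₁, c₂, c₃].Nodup ∧
    ({o, a₁, b₁} : Set S) ∈ L ∧ ({o, a₂, b₂} : Set S) ∈ L ∧ ({o, a₃, b₃} : Set S) ∈ L ∧
    ({a₂, a₃, c₁} : Set S) ∈ L ∧ ({a₁, a₃, c₂} : Set S) ∈ L ∧ ({a₁, a₂, c₃} : Set S) ∈ L ∧
    ({b₂, b₃, c₁} : Set S) ∈ L ∧ ({b₁, b₃, c₂} : Set S) ∈ L ∧ ({b₁, b₂, c₃} : Set S) ∈ L ∧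
    ({c₁, c₂, c₃} : Set S) ∈ L

/-- Three points lie on a common line. -/
def OnCommonLine {P : Type*} (L : Set (Set P)) (p q r : P) : Prop :=
  ∃ l ∈ L, p ∈ l ∧ q ∈ l ∧ r ∈ l

/-- A projective space (of any dimension, finite or not): two distinct points lie on exactly one
line, every line has at least three points, and the axiom of Veblen and Young holds. -/
structure IsProjectiveSpace {P : Type*} (L : Set (Set P)) : Prop where
  existsUnique_line : ∀ p q : P, p ≠ q → ∃! l : Set P, l ∈ L ∧ p ∈ l ∧ q ∈ l
  three_le_encard : ∀ l ∈ L, 3 ≤ l.encard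
  veblen_young : ∀ a b c d : P, [a, b, c, d].Nodup →
    ∀ lab ∈ L, ∀ lcd ∈ L, ∀ lac ∈ L, ∀ lbd ∈ L,
      a ∈ lab → b ∈ lab → c ∈ lcd → d ∈ lcd → a ∈ lac → c ∈ lac → b ∈ lbd → d ∈ lbd →
      (lab ∩ lcd).Nonempty → (lac ∩ lbd).Nonempty

/-- A projective space in which the theorem of Desargues holds: if two triangles are perspective
from a point `o`, then the intersection points of corresponding sides lie on a common line. -/
structure IsDesarguesianProjectiveSpace {P : Type*} (L : Set (Set P)) : Prop
    extends IsProjectiveSpace L where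
  desargues : ∀ o a₁ a₂ a₃ b₁ b₂ b₃ c₁ c₂ c₃ : P,
    [o, a₁, b₁].Nodup → [o, a₂, b₂].Nodup → [o, a₃, b₃].Nodup →
    OnCommonLine L o a₁ b₁ → OnCommonLine L o a₂ b₂ → OnCommonLine L o a₃ b₃ →
    ¬ OnCommonLine L a₁ a₂ a₃ → ¬ OnCommonLine L o a₁ a₂ → ¬ OnCommonLine L o a₁ a₃ →
    ¬ OnCommonLine L o a₂ a₃ →
    ¬ OnCommonLine L b₁ b₂ b₃ → ¬ OnCommonLine L o b₁ b₂ → ¬ OnCommonLine L o b₁ b₃ →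
    ¬ OnCommonLine L o b₂ b₃ →
    OnCommonLine L a₂ a₃ c₁ → OnCommonLine L b₂ b₃ c₁ →
    OnCommonLine L a₁ a₃ c₂ → OnCommonLine L b₁ b₃ c₂ →
    OnCommonLine L a₁ a₂ c₃ → OnCommonLine L b₁ b₂ c₃ →
    OnCommonLine L c₁ c₂ c₃

/-- An embedding of one incidence structure into another: an injective map of the points that maps
the points of every line into a line, distinct lines going into distinct lines. Neither new
incidences among the image points nor non-spanning images are excluded. -/
structure IsEmbeddingOfLines {S P : Type*} (L : Set (Set S)) (L' : Set (Set P)) (f : S → P) :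
    Prop where
  injective : Function.Injective f
  maps_line : ∀ l ∈ L, ∃ k ∈ L', f '' l ⊆ k
  line_injective : ∀ l₁ ∈ L, ∀ l₂ ∈ L, ∀ k ∈ L', f '' l₁ ⊆ k → f '' l₂ ⊆ k → l₁ = l₂

/-- The first structure can be embedded into the second. -/
def IsEmbeddable {S P : Type*} (L : Set (Set S)) (L' : Set (Set P)) : Prop :=
  ∃ f : S → P, IsEmbeddingOfLines L L' f

/-- The lines of the combinatorial Grassmannian `G_2(X)`: its points are the two-element subsets of
`X`, and its lines are the three-element subsets of `X`, the incidence being inclusion. -/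
def grassmannianLines (X : Type*) : Set (Set {s : Finset X // s.card = 2}) :=
  {l | ∃ t : Finset X, t.card = 3 ∧ l = {s | s.1 ⊆ t}}

/-- The lines of the projective space over a vector space: the point sets of the two-dimensional
vector subspaces. -/
def projectiveLines (K V : Type*) [DivisionRing K] [AddCommGroup V] [Module K V] :
    Set (Set (ℙ K V)) :=
  {l | ∃ W : Submodule K V, Module.finrank K W = 2 ∧ l = {p | p.submodule ≤ W}}

/-! Weaving keeps every line of the Desargues configuration except, in effect, its axis. With both
triangles at weight 0, each of the other nine lines has exactly one point off the triangles (the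
centre or an axis point), so it lifts once that point gets weight 1. Desargues' theorem then makes
the images of the three axis points at weight 1 collinear. No weaved line has constant weight,
however, and two different weaved lines over the axis join the first of these points to the other
two; an embedding sends them into different lines, so the three images form a triangle
(`IsEmbeddingOfLines.not_onCommonLine`). The same lemma supplies the nondegeneracy conditions of
Desargues' theorem. For `G_2(X)` and `PG(n,2)` it remains to exhibit the ten points, inside a
five-element subset and a three-dimensional subspace respectively. -/

/-- The weights `(i, i, i + 1)` and their permutations give lines of the weaved configuration. -/
theorem mem_weave_third {S : Type*} {L : Set (Set S)} (m : ℕ) {a b c : S}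
    (h : ({a, b, c} : Set S) ∈ L) (i : ZMod m) :
    ({(a, i), (b, i), (c, i + 1)} : Set (S × ZMod m)) ∈ weave m L :=
  ⟨a, b, c, i, i, i + 1, h, Or.inl ⟨rfl, by simp⟩, rfl⟩

theorem mem_weave_second {S : Type*} {L : Set (Set S)} (m : ℕ) {a b c : S}
    (h : ({a, b, c} : Set S) ∈ L) (i : ZMod m) :
    ({(a, i), (b, i + 1), (c, i)} : Set (S × ZMod m)) ∈ weave m L :=
  ⟨a, b, c, i, i + 1, i, h, Or.inr (Or.inl ⟨rfl, by simp⟩), rfl⟩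

theorem mem_weave_first {S : Type*} {L : Set (Set S)} (m : ℕ) {a b c : S}
    (h : ({a, b, c} : Set S) ∈ L) (i : ZMod m) :
    ({(a, i + 1), (b, i), (c, i)} : Set (S × ZMod m)) ∈ weave m L :=
  ⟨a, b, c, i + 1, i, i, h, Or.inr (Or.inr ⟨rfl, by simp⟩), rfl⟩

/-- The image of a line with three listed points lies on a common line. -/
theorem IsEmbeddingOfLines.onCommonLine {S P : Type*} {L : Set (Set S)} {L' : Set (Set P)}
    {f : S → P} (hf : IsEmbeddingOfLines L L' f) {x y z : S} (h : ({x, y, z} : Set S) ∈ L) :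
    OnCommonLine L' (f x) (f y) (f z) := by
  obtain ⟨k, hk, hsub⟩ := hf.maps_line _ h
  exact ⟨k, hk, hsub ⟨x, by simp, rfl⟩, hsub ⟨y, by simp, rfl⟩, hsub ⟨z, by simp, rfl⟩⟩

/-- An embedding into a projective space sends three points `x, y, y'`, of which `x, y` and `x, y'`
lie on two distinct lines, to non-collinear points. -/
theorem IsEmbeddingOfLines.not_onCommonLine {S P : Type*} {L : Set (Set S)} {L' : Set (Set P)}
    (hP : IsProjectiveSpace L') {f : S → P} (hf : IsEmbeddingOfLines L L' f) {l l' : Set S}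
    (hl : l ∈ L) (hl' : l' ∈ L) (hne : l ≠ l') {x y y' : S} (hxy : x ≠ y) (hxy' : x ≠ y')
    (hx : x ∈ l) (hy : y ∈ l) (hx' : x ∈ l') (hy' : y' ∈ l') :
    ¬ OnCommonLine L' (f x) (f y) (f y') := by
  rintro ⟨k, hk, hkx, hky, hky'⟩
  obtain ⟨k₁, hk₁, h₁⟩ := hf.maps_line l hl
  obtain ⟨k₂, hk₂, h₂⟩ := hf.maps_line l' hl'
  -- Each of the two lines shares two distinct image points with `k`, so both would be sent into
  -- `k`.
  have e₁ : k₁ = k := (hP.existsUnique_line _ _ (hf.injective.ne hxy)).unique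
    ⟨hk₁, h₁ ⟨x, hx, rfl⟩, h₁ ⟨y, hy, rfl⟩⟩ ⟨hk, hkx, hky⟩
  have e₂ : k₂ = k := (hP.existsUnique_line _ _ (hf.injective.ne hxy')).unique
    ⟨hk₂, h₂ ⟨x, hx', rfl⟩, h₂ ⟨y', hy', rfl⟩⟩ ⟨hk, hkx, hky'⟩
  exact hne (hf.line_injective l hl l' hl' k hk (e₁ ▸ h₁) (e₂ ▸ h₂))

/-- A configuration weaved from a structure that contains the Desargues configuration does not
embed into a Desarguesian projective space: the images at weight `0` of the two triangles are
perspective from the image at weight `1` of the centre, so that Desargues' theorem makes the images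
at weight `1` of the three axis points collinear, but these form a triangle. -/
theorem ContainsDesargues.not_isEmbeddable_weave {m : ℕ} (hm : 2 ≤ m) {S P : Type*}
    {L : Set (Set S)} {LP : Set (Set P)} (hP : IsDesarguesianProjectiveSpace LP)
    (hL : ContainsDesargues L) : ¬ IsEmbeddable (weave m L) LP := by
  rintro ⟨f, hf⟩
  obtain ⟨o, a₁, a₂, a₃, b₁, b₂, b₃, c₁, c₂, c₃, hnd, ho₁, ho₂, ho₃, ha₁, ha₂, ha₃,
    hb₁, hb₂, hb₃, hc⟩ := hL
  -- This makes `ZMod m` nontrivial, so that weights `i` and `i + 1` differ.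
  have : Fact (1 < m) := ⟨hm⟩
  simp only [List.nodup_cons, List.mem_cons, List.not_mem_nil, or_false, not_or,
    List.nodup_nil, and_true, not_false_eq_true] at hnd
  have l₁ := mem_weave_first m ho₁ 0
  have l₂ := mem_weave_first m ho₂ 0
  have l₃ := mem_weave_first m ho₃ 0
  have p₁ := mem_weave_third m ha₁ 0
  have p₂ := mem_weave_third m ha₂ 0
  have p₃ := mem_weave_third m ha₃ 0
  have q₁ := mem_weave_third m hb₁ 0
  have q₂ := mem_weave_third m hb₂ 0
  have q₃ := mem_weave_third m hb₃ 0
  -- Both lines pass through `(c₁, 1)`. The first contains `(c₃, 1)` and the second `(c₂, 1)`; they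
  -- differ because `(c₂, 1)` is not the point `(c₂, 2)` of the first.
  have r₂ := mem_weave_second m hc (0 + 1)
  have r₃ := mem_weave_third m hc (0 + 1)
  have key {l l' : Set (S × ZMod m)} (hl : l ∈ weave m L) (hl' : l' ∈ weave m L)
      {x y y' : S × ZMod m} (hy₀ : y ∉ l') (hxy : x ≠ y) (hxy' : x ≠ y')
      (hx : x ∈ l) (hy : y ∈ l) (hx' : x ∈ l') (hy' : y' ∈ l') :
      ¬ OnCommonLine LP (f x) (f y) (f y') :=
    hf.not_onCommonLine hP.toIsProjectiveSpace hl hl' (fun h => hy₀ (h ▸ hy)) hxy hxy' hx hy hx' hy'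
  have nodup {x y z : S × ZMod m} (h : [x, y, z].Nodup) : [f x, f y, f z].Nodup :=
    h.map hf.injective
  -- The outer `key` refutes the collinearity that `hP.desargues` produces. Each inner `key` gives
  -- one nondegeneracy condition, from two weaved lines that meet in the first point of the triple.
  refine key r₃ r₂ (x := (c₁, 0 + 1)) (y := (c₂, 0 + 1)) (y' := (c₃, 0 + 1))
    ?_ ?_ ?_ ?_ ?_ ?_ ?_ (hP.desargues (f (o, 0 + 1)) (f (a₁, 0)) (f (a₂, 0)) (f (a₃, 0))
      (f (b₁, 0)) (f (b₂, 0)) (f (b₃, 0)) _ _ _ (nodup ?_) (nodup ?_) (nodup ?_)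
      (hf.onCommonLine l₁) (hf.onCommonLine l₂) (hf.onCommonLine l₃)
      (key p₃ p₂ ?_ ?_ ?_ ?_ ?_ ?_ ?_)
      (key l₁ l₂ ?_ ?_ ?_ ?_ ?_ ?_ ?_) (key l₁ l₃ ?_ ?_ ?_ ?_ ?_ ?_ ?_)
      (key l₂ l₃ ?_ ?_ ?_ ?_ ?_ ?_ ?_)
      (key q₃ q₂ ?_ ?_ ?_ ?_ ?_ ?_ ?_)
      (key l₁ l₂ ?_ ?_ ?_ ?_ ?_ ?_ ?_) (key l₁ l₃ ?_ ?_ ?_ ?_ ?_ ?_ ?_)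
      (key l₂ l₃ ?_ ?_ ?_ ?_ ?_ ?_ ?_)
      (hf.onCommonLine p₁) (hf.onCommonLine q₁) (hf.onCommonLine p₂) (hf.onCommonLine q₂)
      (hf.onCommonLine p₃) (hf.onCommonLine q₃))
  all_goals simp [hnd, Ne.symm, eq_comm]

/-- Three distinct two-element subsets of a three-element set form a line of `G_2(X)`. -/
theorem mem_grassmannianLines {X : Type*} {s t u : {s : Finset X // s.card = 2}} {w : Finset X}
    (hw : w.card = 3) (hnd : [s, t, u].Nodup) (hs : s.1 ⊆ w) (ht : t.1 ⊆ w) (hu : u.1 ⊆ w) :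
    ({s, t, u} : Set {s : Finset X // s.card = 2}) ∈ grassmannianLines X := by
  classical
  refine ⟨w, hw, ?_⟩
  -- A three-element set has only three two-element subsets, so three distinct ones exhaust them.
  have h : ({s.1, t.1, u.1} : Finset (Finset X)) = w.powersetCard 2 := by
    refine Finset.eq_of_subset_of_card_le ?_ ?_
    · simp [Finset.insert_subset_iff, Finset.mem_powersetCard, s.2, t.2, u.2, hs, ht, hu]
    · rw [Finset.card_powersetCard, hw, Finset.card_eq_three.2 ⟨s.1, t.1, u.1, ?_, ?_, ?_, rfl⟩]
      · decide
      all_goals simp_all [Subtype.ext_iff]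
  ext x
  have hx : x.1 ∈ ({s.1, t.1, u.1} : Finset (Finset X)) ↔ x.1 ∈ w.powersetCard 2 := by rw [h]
  simpa [Finset.mem_powersetCard, x.2, Subtype.ext_iff] using hx

/-- `G_2(X)` contains the Desargues configuration when `X` has at least five elements. -/
theorem containsDesargues_grassmannianLines {X : Type*} (hX : 5 ≤ ENat.card X) :
    ContainsDesargues (grassmannianLines X) := by
  -- Five points of `X` suffice: all checks are decided in `Fin 5` and carried along `e`.
  obtain ⟨e, -⟩ := Fin.Embedding.exists_embedding_disjoint_range_of_add_le_ENat_card
    (s := (∅ : Set X)) (n := 5) (by simpa using hX)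
  let p : {s : Finset (Fin 5) // s.card = 2} ↪ {s : Finset X // s.card = 2} :=
    ⟨fun s => ⟨s.1.map e, by simp [s.2]⟩, fun s t h => by
      simpa [Subtype.ext_iff] using h⟩
  have line (s t u : {s : Finset (Fin 5) // s.card = 2}) (w : Finset (Fin 5)) (hw : w.card = 3)
      (hnd : [s, t, u].Nodup) (hs : s.1 ⊆ w ∧ t.1 ⊆ w ∧ u.1 ⊆ w) :
      ({p s, p t, p u} : Set {s : Finset X // s.card = 2}) ∈ grassmannianLines X :=
    mem_grassmannianLines (w := w.map e) (by simpa using hw) (hnd.map p.injective)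
      (Finset.map_subset_map.2 hs.1) (Finset.map_subset_map.2 hs.2.1)
      (Finset.map_subset_map.2 hs.2.2)
  -- The pattern is `o = {0, 1}`, `aᵢ = {0, i + 1}`, `bᵢ = {1, i + 1}`, and `cₖ` is `{2, 3, 4}`
  -- without `k + 1`.
  have nd : ([⟨{0, 1}, rfl⟩, ⟨{0, 2}, rfl⟩, ⟨{0, 3}, rfl⟩, ⟨{0, 4}, rfl⟩, ⟨{1, 2}, rfl⟩,
      ⟨{1, 3}, rfl⟩, ⟨{1, 4}, rfl⟩, ⟨{3, 4}, rfl⟩, ⟨{2, 4}, rfl⟩, ⟨{2, 3}, rfl⟩] :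
      List {s : Finset (Fin 5) // s.card = 2}).Nodup := by decide
  refine ⟨p ⟨{0, 1}, rfl⟩, p ⟨{0, 2}, rfl⟩, p ⟨{0, 3}, rfl⟩, p ⟨{0, 4}, rfl⟩,
    p ⟨{1, 2}, rfl⟩, p ⟨{1, 3}, rfl⟩, p ⟨{1, 4}, rfl⟩,
    p ⟨{3, 4}, rfl⟩, p ⟨{2, 4}, rfl⟩, p ⟨{2, 3}, rfl⟩,
    nd.map p.injective,
    line _ _ _ {0, 1, 2} ?_ ?_ ?_, line _ _ _ {0, 1, 3} ?_ ?_ ?_, line _ _ _ {0, 1, 4} ?_ ?_ ?_,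
    line _ _ _ {0, 3, 4} ?_ ?_ ?_, line _ _ _ {0, 2, 4} ?_ ?_ ?_, line _ _ _ {0, 2, 3} ?_ ?_ ?_,
    line _ _ _ {1, 3, 4} ?_ ?_ ?_, line _ _ _ {1, 2, 4} ?_ ?_ ?_, line _ _ _ {1, 2, 3} ?_ ?_ ?_,
    line _ _ _ {2, 3, 4} ?_ ?_ ?_⟩ <;> decide

/-- Over `GF(2)` a point of projective space is given by exactly one vector. -/
theorem mk_injective_zmod_two (V : Type*) [AddCommGroup V] [Module (ZMod 2) V] :
    Function.Injective (fun v : {v : V // v ≠ 0} => Projectivization.mk (ZMod 2) v.1 v.2) := by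
  intro v w h
  obtain ⟨a, ha⟩ := (Projectivization.mk_eq_mk_iff _ _ _ v.2 w.2).1 h
  -- The only unit of `GF(2)` is 1.
  rw [Subsingleton.elim a 1, one_smul] at ha
  exact Subtype.ext ha.symm

/-- Over `GF(2)` two distinct points `u`, `v` span the line `{u, v, u + v}`. -/
theorem mem_projectiveLines_zmod_two {V : Type*} [AddCommGroup V] [Module (ZMod 2) V]
    {u v w : V} (hu : u ≠ 0) (hv : v ≠ 0) (hw : w ≠ 0) (h : u + v = w) :
    ({Projectivization.mk (ZMod 2) u hu, Projectivization.mk (ZMod 2) v hv,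
      Projectivization.mk (ZMod 2) w hw} : Set (ℙ (ZMod 2) V)) ∈ projectiveLines (ZMod 2) V := by
  have h01 : ∀ a : ZMod 2, a = 0 ∨ a = 1 := by decide
  have hli : LinearIndependent (ZMod 2) ![u, v] := by
    rw [LinearIndependent.pair_iff]
    intro a b hab
    rcases h01 a with rfl | rfl <;> rcases h01 b with rfl | rfl <;> simp_all
  refine ⟨Submodule.span (ZMod 2) {u, v}, ?_, ?_⟩
  · rw [← Matrix.range_cons_cons_empty u v ![]]
    simpa using finrank_span_eq_card hli
  · ext p
    induction p using Projectivization.ind with | h x hx =>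
    have e {y : V} (hy : y ≠ 0) :
        Projectivization.mk (ZMod 2) x hx = Projectivization.mk (ZMod 2) y hy ↔ x = y :=
      (mk_injective_zmod_two V).eq_iff (a := ⟨x, hx⟩) (b := ⟨y, hy⟩) |>.trans
        Subtype.ext_iff
    simp only [Set.mem_insert_iff, Set.mem_singleton_iff, e, Set.mem_ofPred_eq,
      Projectivization.submodule_mk, Submodule.span_singleton_le_iff_mem, Submodule.mem_span_pair]
    constructor
    · rintro (rfl | rfl | rfl)
      exacts [⟨1, 0, by simp⟩, ⟨0, 1, by simp⟩, ⟨1, 1, by simpa using h⟩]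
    · rintro ⟨a, b, hab⟩
      -- The four combinations are `0`, `v`, `u`, `u + v`; the first is excluded because `x` is
      -- nonzero.
      rcases h01 a with rfl | rfl <;> rcases h01 b with rfl | rfl <;> simp at hab
      exacts [absurd hab.symm hx, .inr (.inl hab.symm), .inl hab.symm,
        .inr (.inr (hab.symm.trans h))]

/-- `PG(n, 2)` contains the Desargues configuration when `n` is at least three. -/
theorem containsDesargues_projectiveLines_zmod_two {n : ℕ} (hn : 3 ≤ n) :
    ContainsDesargues (projectiveLines (ZMod 2) (Fin (n + 1) → ZMod 2)) := by
  -- Extension by zero places `PG(3,2)` inside `PG(n,2)`, which leaves a finite check on vectors of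
  -- length four.
  let g : (Fin 4 → ZMod 2) →ₗ[ZMod 2] (Fin (n + 1) → ZMod 2) :=
    Function.ExtendByZero.linearMap (ZMod 2) (Fin.castLE (by omega))
  have hg : Function.Injective g := by
    intro x y h
    funext i
    have := congrFun h (Fin.castLE (by omega) i)
    simpa [g, (Fin.castLE_injective (by omega : 4 ≤ n + 1)).extend_apply] using this
  let q (x : {x : Fin 4 → ZMod 2 // x ≠ 0}) : {v : Fin (n + 1) → ZMod 2 // v ≠ 0} :=
    ⟨g x.1, (map_ne_zero_iff g hg).2 x.2⟩
  let p (x : {x : Fin 4 → ZMod 2 // x ≠ 0}) : ℙ (ZMod 2) (Fin (n + 1) → ZMod 2) :=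
    Projectivization.mk (ZMod 2) (q x).1 (q x).2
  have hp : Function.Injective p := (mk_injective_zmod_two _).comp fun x y h =>
    Subtype.ext (hg (congrArg Subtype.val h))
  have line (x y z : {x : Fin 4 → ZMod 2 // x ≠ 0}) (h : x.1 + y.1 = z.1) :
      ({p x, p y, p z} : Set (ℙ (ZMod 2) (Fin (n + 1) → ZMod 2))) ∈
        projectiveLines (ZMod 2) (Fin (n + 1) → ZMod 2) :=
    mem_projectiveLines_zmod_two _ _ _ (by rw [← map_add, h])
  -- With the standard basis `e₀, …, e₃`: `o = e₀`, `aᵢ = eᵢ`, `bᵢ = e₀ + eᵢ`, and `cₖ = eᵢ + eⱼ`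
  -- for `{i, j, k} = {1, 2, 3}`. In characteristic 2 each of the ten lines is then a triple in
  -- which two vectors sum to the third.
  have nd : ([⟨![1, 0, 0, 0], by decide⟩, ⟨![0, 1, 0, 0], by decide⟩,
      ⟨![0, 0, 1, 0], by decide⟩, ⟨![0, 0, 0, 1], by decide⟩, ⟨![1, 1, 0, 0], by decide⟩,
      ⟨![1, 0, 1, 0], by decide⟩, ⟨![1, 0, 0, 1], by decide⟩, ⟨![0, 0, 1, 1], by decide⟩,
      ⟨![0, 1, 0, 1], by decide⟩, ⟨![0, 1, 1, 0], by decide⟩] :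
      List {x : Fin 4 → ZMod 2 // x ≠ 0}).Nodup := by decide
  refine ⟨_, _, _, _, _, _, _, _, _, _, nd.map hp,
    line _ _ _ ?_, line _ _ _ ?_, line _ _ _ ?_, line _ _ _ ?_, line _ _ _ ?_, line _ _ _ ?_,
    line _ _ _ ?_, line _ _ _ ?_, line _ _ _ ?_, line _ _ _ ?_⟩ <;> decide

theorem mainTheorem12 (m : ℕ) (hm : 3 ≤ m)
    {P : Type*} (LP : Set (Set P)) (hP : IsDesarguesianProjectiveSpace LP) :
    (∀ (S : Type*) (L : Set (Set S)), IsPartialSteinerTripleSystem L → ContainsDesargues L →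
      ¬ IsEmbeddable (weave m L) LP) ∧
    (∀ X : Type*, 5 ≤ ENat.card X → ¬ IsEmbeddable (weave m (grassmannianLines X)) LP) ∧
    (∀ n : ℕ, 3 ≤ n →
      ¬ IsEmbeddable (weave m (projectiveLines (ZMod 2) (Fin (n + 1) → ZMod 2))) LP) :=
  have hm' : 2 ≤ m := by omega
  ⟨fun _ _ _ hL => hL.not_isEmbeddable_weave hm' hP,
    fun _ hX => (containsDesargues_grassmannianLines hX).not_isEmbeddable_weave hm' hP,
    fun _ hn => (containsDesargues_projectiveLines_zmod_two hn).not_isEmbeddable_weave hm' hP⟩
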